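/- **Conventions.** A *plabic graph* $G$ is a nonempty finite planar graph embedded in a closed disk (loops and multiple edges allowed), considered up to isotopy, whose boundary vertices lie on the boundary circle, have degree $1$ and are labelled in clockwise order, and whose interior vertices are coloured black or white. Interior vertices may have any degree (in particular trivalent graphs are included). It is assumed that every interior face of $G$ is simply connected, i.e. that no interior face contains another connected component of $G$; here a face is *interior* if it is not adjacent to the boundary of the disk. The *planar dual* $Q_G$ is the directed multigraph whose vertices are the interior faces of $G$ and which has one arrow for every edge $e$ of $G$ whose endpoints are interior vertices of different colours and both of whose sides lie in interior faces (possibly the same face); the arrow crosses $e$ from one of these faces to the other so that the white endpoint of $e$ is on its left. A *quiver* is a finite directed multigraph without directed cycles of length $1$ or $2$; $G$ is *simple* if $Q_G$ is a quiver. The *reduced dual quiver* $Q_G^{\mathrm{red}}$ is obtained from $Q_G$ by removing all loops and cancelling directed $2$-cycles one by one. For a directed multigraph $Q$ with $n$ vertices, $B(Q)=(b_{ij})$ is the $n\times n$ matrix with $b_{ij}=\#\{i\to j\}-\#\{j\to i\}$, and $\operatorname{cork}(Q)=n-\operatorname{rk}B(Q)$. An *ice quiver* $\widetilde Q$ with mutable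 part $Q$ is a quiver with additional "frozen" vertices and no arrows between frozen vertices, whose induced subquiver on the other, "mutable", vertices is $Q$. With $m$ frozen vertices, its extended exchange matrix $\widetilde B$ is the $(n+m)\times n$ matrix with entries $b_{ij}=\#\{i\to j\}-\#\{j\to i\}$, where $j$ runs over the mutable vertices and $i$ over all vertices. $\widetilde Q$ is *really full rank* if the rows of $\widetilde B$ span $\mathbb Z^n$ over $\mathbb Z$. A *minimal extension* of a quiver $Q$ is an ice quiver with mutable part $Q$ that has exactly $m=\operatorname{cork}(Q)$ frozen vertices and is really full rank. **Proposition.** 1. For every plabic graph $G$, with $n$ interior faces, the reduced dual quiver $Q_G^{\mathrm{red}}$ is torsion-free: the abelian group $\mathbb Z^n/B(Q_G^{\mathrm{red}})^T\mathbb Z^n$ has no torsion. 2. For every simple plabic graph $G$, the quiver $Q_G$ admits a minimal extension. -/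

import Mathlib

/-! ### Directed multigraphs, quivers, ice quivers -/

/-- A directed multigraph with vertex set `V`: `arr u v` is the number of arrows `u → v`. -/
structure DiMultigraph (V : Type) where
  arr : V → V → ℕ

namespace DiMultigraph

variable {V : Type}

/-- A quiver is a directed multigraph without directed cycles of length `1` and `2`. -/
def IsQuiver (Q : DiMultigraph V) : Prop :=
  (∀ u, Q.arr u u = 0) ∧ ∀ u v, Q.arr u v = 0 ∨ Q.arr v u = 0

/-- Remove all loops and cancel the directed `2`-cycles one by one. From `a` arrows `u → v` and
`b` arrows `v → u`, there remain `a - min a b` arrows `u → v`, which is the truncated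
subtraction `a - b`; for `u = v` nothing remains. -/
def red (Q : DiMultigraph V) : DiMultigraph V where
  arr u v := Q.arr u v - Q.arr v u

/-- The exchange matrix `B(Q)`. -/
def exchangeMatrix (Q : DiMultigraph V) : Matrix V V ℤ :=
  fun i j => (Q.arr i j : ℤ) - (Q.arr j i : ℤ)

/-- The corank `n - rk B(Q)`, where `n` is the number of vertices. -/
noncomputable def cork [Fintype V] (Q : DiMultigraph V) : ℕ :=
  Fintype.card V - (Q.exchangeMatrix.map (Int.cast : ℤ → ℚ)).rank

/-- `Q` is torsion-free: the abelian group `ℤⁿ / B(Q)ᵀ ℤⁿ` has no torsion. -/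
def TorsionFree [Fintype V] (Q : DiMultigraph V) : Prop :=
  IsAddTorsionFree ((V → ℤ) ⧸ LinearMap.range Q.exchangeMatrix.transpose.mulVecLin)

end DiMultigraph

/-- An ice quiver with mutable vertices `V` and frozen vertices `M`: a quiver on `V ⊔ M` with no
arrows between frozen vertices. -/
structure IceQuiver (V M : Type) extends DiMultigraph (V ⊕ M) where
  isQuiver : toDiMultigraph.IsQuiver
  frozen_arr : ∀ a b : M, arr (Sum.inr a) (Sum.inr b) = 0

namespace IceQuiver

variable {V M : Type}

/-- The induced subgraph on the mutable vertices. -/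
def mutablePart (Q : IceQuiver V M) : DiMultigraph V where
  arr u v := Q.arr (Sum.inl u) (Sum.inl v)

/-- The extended `(n + m) × n` exchange matrix. -/
def extExchangeMatrix (Q : IceQuiver V M) : Matrix (V ⊕ M) V ℤ :=
  fun i j => (Q.arr i (Sum.inl j) : ℤ) - (Q.arr (Sum.inl j) i : ℤ)

/-- Really full rank: the rows of the extended exchange matrix span `ℤⁿ` over `ℤ`. -/
def ReallyFullRank (Q : IceQuiver V M) : Prop :=
  Submodule.span ℤ (Set.range fun i : V ⊕ M => Q.extExchangeMatrix i) = ⊤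

end IceQuiver

/-- `Qt` is a minimal extension of `Q`: an ice quiver with mutable part `Q`, with
`m = cork Q` frozen vertices, and really full rank. -/
def IsMinimalExtension {V : Type} [Fintype V] {m : ℕ}
    (Q : DiMultigraph V) (Qt : IceQuiver V (Fin m)) : Prop :=
  Qt.mutablePart = Q ∧ m = Q.cork ∧ Qt.ReallyFullRank

/-! ### Graphs embedded in a disk -/

/-- The set of orbits of `f`. -/
abbrev Orbits {D : Type} (f : D → D) : Type := Quot fun a b : D => b = f a

/-- A combinatorial map in a closed disk: a finite graph embedded in the disk is recorded by its
finite set `D` of half-edges. Collapsing the boundary circle of the disk to a point `∗` turns the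
disk into a sphere, and `rot` is the clockwise rotation around each vertex on that sphere. -/
structure DiskMap where
  /-- the number of boundary vertices, which lie on the boundary circle -/
  N : ℕ
  /-- the half-edges -/
  D : Type
  [finD : Finite D]
  /-- the other half of the same edge -/
  opp : Equiv.Perm D
  opp_opp : ∀ d, opp (opp d) = d
  opp_ne : ∀ d, opp d ≠ d
  /-- the next half-edge in clockwise order around the same vertex of the sphere -/
  rot : Equiv.Perm D
  /-- the unique half-edge at the boundary vertex `i` -/
  bdry : Fin N → D
  bdry_injective : Function.Injective bdry
  /-- The boundary vertices `0, …, N - 1` are in clockwise order along the circle as seen from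
  inside the disk, hence in counterclockwise order around `∗`. -/
  rot_bdry : ∀ i, rot (bdry (finRotate N i)) = bdry i

attribute [instance] DiskMap.finD

namespace DiskMap

/-- Follow an edge to its other end, then turn left as sharply as possible: this walks around the
region to the left of the half-edge (directed away from its vertex). -/
def faceStep (M : DiskMap) (d : M.D) : M.D := M.rot (M.opp d)

/-- The boundary walks of the regions; `M.leftFace d` is the one to the left of `d`. -/
abbrev Face (M : DiskMap) : Type := Orbits M.faceStep

/-- The region to the left of the half-edge `d`. -/
def leftFace (M : DiskMap) (d : M.D) : M.Face := Quot.mk _ d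

/-- The connected components (having at least one edge) of the map on the sphere. -/
abbrev Component (M : DiskMap) : Type :=
  Quot fun a b : M.D => b = M.rot a ∨ b = M.opp a

/-- The connected component containing `d`. -/
def component (M : DiskMap) (d : M.D) : M.Component := Quot.mk _ d

/-- Planarity, by Euler's formula `#V - #E + #F = 2c` for a map with `c` components, each of which
is drawn on the sphere. -/
def IsPlanar (M : DiskMap) : Prop :=
  Nat.card (Orbits M.rot) + Nat.card M.Face = Nat.card (Orbits M.opp) + 2 * Nat.card M.Component

/-- A component without boundary vertices. -/
def IsFloating (M : DiskMap) (c : M.Component) : Prop :=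
  ∀ i, M.component (M.bdry i) ≠ c

end DiskMap

inductive VertexColor where
  | black
  | white

/-- A plabic graph: a nonempty planar graph embedded in a disk, whose boundary vertices have degree
one and whose interior vertices are coloured black and white; loops, multiple edges and interior
vertices of any degree are allowed. No interior face contains another component of the graph.
Hence every component without boundary vertices lies in a face that meets the boundary of the
disk, and one of its walks, its `outerFace`, belongs to that boundary face; all other walks are
unaffected by the relative position of the components. -/
structure PlabicGraph extends DiskMap where
  /-- the interior vertices -/
  I : Type
  [finI : Finite I]
  color : I → VertexColor
  nonempty : Nonempty (Fin N ⊕ I)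
  /-- the vertex at which a half-edge starts -/
  org : D → Fin N ⊕ I
  org_eq_inl_iff : ∀ d i, org d = Sum.inl i ↔ d = bdry i
  org_rot : ∀ d v, org d = Sum.inr v → org (rot d) = Sum.inr v
  sameCycle_of_org : ∀ d d' v, org d = Sum.inr v → org d' = Sum.inr v → rot.SameCycle d d'
  isPlanar : toDiskMap.IsPlanar
  /-- the walk of a floating component that faces the boundary of the disk -/
  outerFace : {c : toDiskMap.Component // toDiskMap.IsFloating c} → toDiskMap.Face
  outerFace_mem : ∀ c, ∃ d, toDiskMap.leftFace d = outerFace c ∧ toDiskMap.component d = c.1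

namespace PlabicGraph

/-- A region is part of a boundary face if its walk passes through a boundary vertex or it is the
outer walk of a component without boundary vertices. -/
def IsBoundaryFace (G : PlabicGraph) (f : G.Face) : Prop :=
  (∃ i, G.leftFace (G.bdry i) = f) ∨ ∃ c, G.outerFace c = f

/-- The interior faces: those that are not adjacent to the boundary of the disk. -/
abbrev InteriorFace (G : PlabicGraph) : Type := {f : G.Face // ¬ G.IsBoundaryFace f}

noncomputable instance (G : PlabicGraph) : Fintype G.InteriorFace := Fintype.ofFinite _

/-- The half-edge `d` starts at an interior vertex of colour `x`. -/
def StartsAt (G : PlabicGraph) (x : VertexColor) (d : G.D) : Prop :=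
  ∃ v, G.org d = Sum.inr v ∧ G.color v = x

/-- The planar dual `Q_G`. Its vertices are the interior faces. An edge with endpoints of
different colours is recorded by its half-edge `d` directed from white to black; its arrow crosses
`d` from right to left, so that the white endpoint is on the left of the arrow. -/
noncomputable def dualGraph (G : PlabicGraph) : DiMultigraph G.InteriorFace where
  arr F F' := Nat.card {d : G.D // G.StartsAt .white d ∧ G.StartsAt .black (G.opp d) ∧
    G.leftFace (G.opp d) = F.1 ∧ G.leftFace d = F'.1}

/-- The reduced dual quiver. -/
noncomputable def reducedDualQuiver (G : PlabicGraph) : DiMultigraph G.InteriorFace :=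
  G.dualGraph.red

/-- `G` is simple if its planar dual is a quiver. -/
def IsSimple (G : PlabicGraph) : Prop := G.dualGraph.IsQuiver

end PlabicGraph

open Module

lemma Orbits.mk_apply {D : Type} (f : D → D) (d : D) :
    (Quot.mk _ (f d) : Orbits f) = Quot.mk _ d :=
  Eq.symm (Quot.sound (r := fun a b : D => b = f a) rfl)

namespace DiskMap

noncomputable instance (M : DiskMap) : Fintype M.D := Fintype.ofFinite _

variable (M : DiskMap)

/-- The edges. -/
abbrev Edge : Type := Orbits M.opp

noncomputable instance : Fintype M.Edge := Fintype.ofFinite _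
noncomputable instance : Fintype M.Component := Fintype.ofFinite _

/-- The edge containing a half-edge. -/
def edge (d : M.D) : M.Edge := Quot.mk _ d

/-- A chosen half-edge of each edge. -/
noncomputable def rep (e : M.Edge) : M.D := Quot.out e

lemma edge_rep (e : M.Edge) : M.edge (M.rep e) = e := Quot.out_eq e

lemma edge_opp (d : M.D) : M.edge (M.opp d) = M.edge d := Orbits.mk_apply M.opp d

lemma edge_eq_iff {d d' : M.D} : M.edge d = M.edge d' ↔ d = d' ∨ d = M.opp d' := by
  constructor
  · intro h
    have h' := Quot.eqvGen_exact h
    induction h' with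
    | rel a b hab => exact Or.inr (by rw [hab, M.opp_opp])
    | refl a => exact Or.inl rfl
    | symm a b _ ih =>
      rcases ih (Quot.eqvGen_sound ‹_›) with h | h
      · exact Or.inl h.symm
      · exact Or.inr (by rw [h, M.opp_opp])
    | trans a b c hab hbc ih1 ih2 =>
      rcases ih1 (Quot.eqvGen_sound hab) with h | h <;>
        rcases ih2 (Quot.eqvGen_sound hbc) with h' | h'
      · exact Or.inl (h.trans h')
      · exact Or.inr (h.trans h')
      · exact Or.inr (by rw [h, h'])
      · exact Or.inl (by rw [h, h', M.opp_opp])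
  · rintro (rfl | rfl)
    · rfl
    · exact M.edge_opp _

lemma rep_edge (d : M.D) : M.rep (M.edge d) = d ∨ M.rep (M.edge d) = M.opp d :=
  M.edge_eq_iff.1 (M.edge_rep _)

lemma sum_eq_sum_edge {R : Type*} [AddCommMonoid R] (φ : M.D → R) :
    ∑ d, φ d = ∑ e, (φ (M.rep e) + φ (M.opp (M.rep e))) := by
  classical
  rw [← Finset.sum_fiberwise Finset.univ M.edge φ]
  refine Finset.sum_congr rfl fun e _ => ?_
  have : (Finset.univ.filter fun d => M.edge d = e) = {M.rep e, M.opp (M.rep e)} := by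
    ext d
    rw [Finset.mem_filter, Finset.mem_insert, Finset.mem_singleton, ← M.edge_eq_iff, edge_rep]
    simp
  rw [this, Finset.sum_pair (M.opp_ne _).symm]

section Coboundary

variable {K : Type} [Field K]

/-- The differences across edges of a function on the orbits of `f`. -/
noncomputable def coboundary (K : Type) [Field K] (f : M.D → M.D) :
    (Orbits f → K) →ₗ[K] (M.Edge → K) where
  toFun u e := u (Quot.mk _ (M.rep e)) - u (Quot.mk _ (M.opp (M.rep e)))
  map_add' u v := by ext e; simp only [Pi.add_apply]; ring
  map_smul' c u := by ext e; simp only [Pi.smul_apply, smul_eq_mul, RingHom.id_apply]; ring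

lemma finrank_range_coboundary (f : M.D → M.D)
    (hcomp : ∀ d, M.component (f d) = M.component d)
    (hconn : ∀ u : M.D → K, (∀ d, u (f d) = u d) → (∀ d, u (M.opp d) = u d) →
      ∀ d, u (M.rot d) = u d) :
    finrank K (LinearMap.range (M.coboundary K f)) + Nat.card M.Component =
      Nat.card (Orbits f) := by
  have : Fintype (Orbits f) := Fintype.ofFinite _
  let p : Orbits f → M.Component := Quot.lift M.component fun a b h => by rw [h, hcomp]
  have hp : Function.Surjective p := by
    intro c
    induction c using Quot.ind with
    | mk d => exact ⟨Quot.mk _ d, rfl⟩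
  have hker : LinearMap.ker (M.coboundary K f) = LinearMap.range (LinearMap.funLeft K K p) := by
    ext u
    rw [LinearMap.mem_ker, LinearMap.mem_range]
    constructor
    · intro hu
      have hopp : ∀ d, u (Quot.mk _ (M.opp d)) = u (Quot.mk _ d) := by
        intro d
        have h := congrFun hu (M.edge d)
        change u (Quot.mk _ (M.rep (M.edge d))) - u (Quot.mk _ (M.opp (M.rep (M.edge d)))) = 0 at h
        rcases M.rep_edge d with h' | h' <;> rw [h'] at h
        · exact (sub_eq_zero.1 h).symm
        · rw [M.opp_opp] at h
          exact sub_eq_zero.1 h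
      have hrot := hconn (fun d => u (Quot.mk _ d))
        (fun d => congrArg u (Orbits.mk_apply f d)) hopp
      refine ⟨Quot.lift (fun d => u (Quot.mk _ d)) ?_, ?_⟩
      · rintro a b (rfl | rfl)
        · exact (hrot a).symm
        · exact (hopp a).symm
      · ext o
        induction o using Quot.ind with
        | mk d => rfl
    · rintro ⟨w, rfl⟩
      ext e
      change w (M.component _) - w (M.component _) = 0
      rw [sub_eq_zero]
      exact congrArg w (Quot.sound (Or.inr rfl))
  have h := LinearMap.finrank_range_add_finrank_ker (M.coboundary K f)
  rw [hker, LinearMap.finrank_range_of_inj (LinearMap.funLeft_injective_of_surjective K K p hp),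
    finrank_fintype_fun_eq_card, finrank_fintype_fun_eq_card, ← Nat.card_eq_fintype_card,
    ← Nat.card_eq_fintype_card] at h
  exact h

lemma component_rot (d : M.D) : M.component (M.rot d) = M.component d :=
  Eq.symm (Quot.sound (r := fun a b : M.D => b = M.rot a ∨ b = M.opp a) (Or.inl rfl))

lemma component_opp (d : M.D) : M.component (M.opp d) = M.component d :=
  Eq.symm (Quot.sound (r := fun a b : M.D => b = M.rot a ∨ b = M.opp a) (Or.inr rfl))

lemma component_faceStep (d : M.D) : M.component (M.faceStep d) = M.component d := by
  rw [faceStep, component_rot, component_opp]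

lemma leftFace_faceStep (d : M.D) : M.leftFace (M.faceStep d) = M.leftFace d :=
  Orbits.mk_apply M.faceStep d

lemma leftFace_rot (d : M.D) : M.leftFace (M.rot d) = M.leftFace (M.opp d) := by
  rw [← M.leftFace_faceStep (M.opp d), faceStep, M.opp_opp]

/-- The first homology of the sphere vanishes: every cycle is the boundary of a function on the
faces. -/
theorem exists_face_potential (hM : M.IsPlanar) (a : M.D → K) (ha : ∀ d, a (M.opp d) = -a d)
    (hc : ∀ C : M.D → K, (∀ d, C (M.rot d) = C d) → ∑ d, C d * a d = 0) :
    ∃ x : M.Face → K, ∀ d, a d = x (M.leftFace d) - x (M.leftFace (M.opp d)) := by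
  classical
  have : Fintype (Orbits M.rot) := Fintype.ofFinite _
  have : Fintype M.Face := Fintype.ofFinite _
  have hF := M.finrank_range_coboundary (K := K) M.faceStep M.component_faceStep
    (fun u h1 h2 d => by rw [← h2 d, ← h1 (M.opp d), faceStep, M.opp_opp])
  have hV := M.finrank_range_coboundary (K := K) M.rot M.component_rot (fun u h1 _ => h1)
  set A := LinearMap.toMatrix' (M.coboundary K M.rot) with hA
  have hAC : ∀ C, A.mulVec C = M.coboundary K M.rot C := fun C => by
    rw [hA, ← Matrix.toLin'_apply, Matrix.toLin'_toMatrix']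
  have hrank : A.rank = finrank K (LinearMap.range (M.coboundary K M.rot)) := by
    rw [Matrix.rank, hA, ← Matrix.toLin'_apply', Matrix.toLin'_toMatrix']
  have hker := LinearMap.finrank_range_add_finrank_ker A.transpose.mulVecLin
  rw [← Matrix.rank, Matrix.rank_transpose, hrank, finrank_fintype_fun_eq_card,
    ← Nat.card_eq_fintype_card] at hker
  have mem_ker : ∀ z : M.Edge → K, z ∈ LinearMap.ker A.transpose.mulVecLin ↔
      ∀ C, ∑ e, z e * M.coboundary K M.rot C e = 0 := by
    intro z
    have key : ∀ C, (A.transpose.mulVec z) ⬝ᵥ C = ∑ e, z e * M.coboundary K M.rot C e := by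
      intro C
      rw [Matrix.mulVec_transpose, ← Matrix.dotProduct_mulVec, hAC]
      rfl
    rw [LinearMap.mem_ker, Matrix.mulVecLin_apply]
    constructor
    · intro h C
      rw [← key, h, zero_dotProduct]
    · intro h
      exact dotProduct_eq_zero _ (fun C => by rw [key, h])
  have edge_sum : ∀ (b : M.D → K), (∀ d, b (M.opp d) = -b d) → ∀ C : Orbits M.rot → K,
      ∑ e, b (M.rep e) * M.coboundary K M.rot C e = ∑ d, C (Quot.mk _ d) * b d := by
    intro b hb C
    rw [M.sum_eq_sum_edge]
    refine Finset.sum_congr rfl fun e _ => ?_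
    change b (M.rep e) * (C _ - C _) = _
    rw [hb]
    ring
  have hle : LinearMap.range (M.coboundary K M.faceStep) ≤
      LinearMap.ker A.transpose.mulVecLin := by
    rintro _ ⟨x, rfl⟩
    rw [mem_ker]
    intro C
    have := edge_sum (fun d => x (M.leftFace d) - x (M.leftFace (M.opp d)))
      (fun d => by rw [M.opp_opp]; ring) C
    refine Eq.trans this ?_
    simp_rw [mul_sub]
    rw [Finset.sum_sub_distrib, sub_eq_zero,
      ← Equiv.sum_comp M.rot fun d => C (Quot.mk _ d) * x (M.leftFace d)]
    refine Finset.sum_congr rfl fun d _ => ?_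
    rw [M.leftFace_rot]
    congr 2
    exact Orbits.mk_apply M.rot d
  have heq := Submodule.eq_of_le_of_finrank_eq hle (by
    unfold IsPlanar Face at hM
    change Nat.card (Orbits M.rot) + _ = Nat.card M.Edge + _ at hM
    omega)
  have hmem : (fun e => a (M.rep e)) ∈ LinearMap.ker A.transpose.mulVecLin := by
    rw [mem_ker]
    intro C
    rw [edge_sum a ha C]
    exact hc _ fun d => congrArg C (Orbits.mk_apply M.rot d)
  rw [← heq] at hmem
  obtain ⟨x, hx⟩ := hmem
  refine ⟨x, fun d => ?_⟩
  have h : x (M.leftFace (M.rep (M.edge d))) - x (M.leftFace (M.opp (M.rep (M.edge d)))) =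
    a (M.rep (M.edge d)) := congrFun hx (M.edge d)
  rcases M.rep_edge d with h' | h' <;> rw [h'] at h
  · exact h.symm
  · rw [M.opp_opp, ha] at h
    linear_combination h

end Coboundary

end DiskMap

namespace PlabicGraph

variable (G : PlabicGraph)

variable {G} in
lemma forall_face {P : G.Face → Prop} (hb : ∀ f, G.IsBoundaryFace f → P f)
    (he : ∀ d, P (G.leftFace d) → P (G.leftFace (G.opp d))) (f : G.Face) : P f := by
  have he' : ∀ d, P (G.leftFace (G.opp d)) ↔ P (G.leftFace d) := fun d =>
    ⟨fun h => by simpa only [G.opp_opp] using he _ h, he d⟩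
  let q : G.Component → Prop := Quot.lift (fun d => P (G.leftFace d)) (by
    rintro a b (rfl | rfl)
    · rw [G.leftFace_rot, he']
    · exact propext (he' a).symm)
  have hq : ∀ {d d'}, G.component d = G.component d' → P (G.leftFace d) → P (G.leftFace d') :=
    fun {d d'} h h1 => show q (G.component d') from h ▸ h1
  induction f using Quot.ind with
  | mk d =>
    by_cases hd : G.IsFloating (G.component d)
    · obtain ⟨d', h1, h2⟩ := G.outerFace_mem ⟨_, hd⟩
      exact hq h2 (hb _ (Or.inr ⟨_, h1.symm⟩))
    · unfold DiskMap.IsFloating at hd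
      push Not at hd
      obtain ⟨i, hi⟩ := hd
      exact hq hi (hb _ (Or.inl ⟨i, rfl⟩))

/-- One of the sides of the edge of `d` lies in an interior face. -/
def IsInner (d : G.D) : Prop :=
  ¬ (G.IsBoundaryFace (G.leftFace d) ∧ G.IsBoundaryFace (G.leftFace (G.opp d)))

variable {G}

lemma isInner_opp {d : G.D} : G.IsInner (G.opp d) ↔ G.IsInner d := by
  unfold IsInner
  rw [G.opp_opp, and_comm]

lemma not_isInner_bdry (i : Fin G.N) : ¬ G.IsInner (G.bdry i) := by
  refine not_not.2 ⟨Or.inl ⟨i, rfl⟩, Or.inl ⟨(finRotate G.N).symm i, ?_⟩⟩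
  rw [← G.leftFace_rot, ← G.rot_bdry, Equiv.apply_symm_apply]

lemma eq_of_finRotate {α : Type*} {n : ℕ} (u : Fin n → α) (h : ∀ i, u (finRotate n i) = u i)
    (i j : Fin n) : u i = u j := by
  cases n with
  | zero => exact i.elim0
  | succ n =>
    have h0 : ∀ k, u k = u 0 := by
      intro k
      induction k using Fin.induction with
      | zero => rfl
      | succ k ih => rw [← ih, ← h k.castSucc, finRotate_apply, Fin.coeSucc_eq_succ]
    rw [h0 i, h0 j]

section Field

variable {K : Type} [Field K]

/-- A cycle which avoids the edges between boundary faces is the boundary of a function on the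
interior faces. -/
theorem exists_interior_face_potential (a : G.D → K) (ha : ∀ d, a (G.opp d) = -a d)
    (hc : ∀ C : G.D → K, (∀ d, C (G.rot d) = C d) → ∑ d, C d * a d = 0)
    (h0 : ∀ d, ¬ G.IsInner d → a d = 0) :
    ∃ x : G.Face → K, (∀ f, G.IsBoundaryFace f → x f = 0) ∧
      ∀ d, a d = x (G.leftFace d) - x (G.leftFace (G.opp d)) := by
  classical
  obtain ⟨x, hx⟩ := G.exists_face_potential G.isPlanar a ha hc
  have hbdry : ∀ i j, x (G.leftFace (G.bdry i)) = x (G.leftFace (G.bdry j)) := by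
    refine eq_of_finRotate _ fun i => ?_
    have h := hx (G.bdry (finRotate G.N i))
    rw [h0 _ (not_isInner_bdry _), ← G.leftFace_rot, G.rot_bdry] at h
    exact sub_eq_zero.1 h.symm
  let κ : G.Component → K := fun c =>
    if h : G.IsFloating c then x (G.outerFace ⟨c, h⟩) else
      x (G.leftFace (G.bdry (not_forall.1 h).choose))
  let y : G.Face → K := Quot.lift (fun d => x (G.leftFace d) - κ (G.component d)) (by
    rintro a b rfl
    rw [G.component_faceStep, G.leftFace_faceStep])
  have hy : ∀ d, y (G.leftFace d) = x (G.leftFace d) - κ (G.component d) := fun d => rfl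
  refine ⟨y, ?_, fun d => ?_⟩
  · rintro _ (⟨i, rfl⟩ | ⟨c, rfl⟩)
    · have : ¬ G.IsFloating (G.component (G.bdry i)) := fun h => h i rfl
      rw [hy, sub_eq_zero]
      simp only [κ, dif_neg this]
      exact hbdry _ _
    · obtain ⟨d, h1, h2⟩ := G.outerFace_mem c
      rw [← h1, hy, h2, sub_eq_zero]
      simp only [κ, dif_pos c.2]
      rw [h1]
  · rw [hx, hy, hy, G.component_opp]
    ring

/-- A cochain with vanishing sum around all interior faces is a coboundary away from the edges
between boundary faces. -/
theorem exists_vertex_potential (ω : G.D → K) (hω : ∀ d, ω (G.opp d) = -ω d)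
    (h0 : ∀ d, ¬ G.IsInner d → ω d = 0)
    (hf : ∀ x : G.Face → K, (∀ f, G.IsBoundaryFace f → x f = 0) →
      ∑ d, x (G.leftFace d) * ω d = 0) :
    ∃ C : G.D → K, (∀ d, C (G.rot d) = C d) ∧
      ∀ d, G.IsInner d → ω d = C (G.opp d) - C d := by
  classical
  let δ : (Orbits G.rot → K) →ₗ[K] (G.Edge → K) :=
    { toFun := fun C e => if G.IsInner (G.rep e) then
        C (Quot.mk _ (G.opp (G.rep e))) - C (Quot.mk _ (G.rep e)) else 0
      map_add' := fun u v => by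
        ext e; simp only [Pi.add_apply]; split_ifs <;> ring
      map_smul' := fun c u => by
        ext e; simp only [Pi.smul_apply, smul_eq_mul, RingHom.id_apply]; split_ifs <;> ring }
  have hδ : ∀ C e, δ C e = if G.IsInner (G.rep e) then
        C (Quot.mk _ (G.opp (G.rep e))) - C (Quot.mk _ (G.rep e)) else 0 := fun _ _ => rfl
  by_cases hmem : (fun e => ω (G.rep e)) ∈ LinearMap.range δ
  · obtain ⟨C, hC⟩ := hmem
    refine ⟨fun d => C (Quot.mk _ d), fun d => congrArg C (Orbits.mk_apply G.rot d), fun d hd => ?_⟩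
    have h := congrFun hC (G.edge d)
    rw [hδ] at h
    rcases G.rep_edge d with h' | h' <;> rw [h'] at h
    · rw [if_pos hd] at h
      exact h.symm
    · rw [if_pos (isInner_opp.2 hd), G.opp_opp, hω] at h
      linear_combination h
  · exfalso
    obtain ⟨φ, hφ, hle⟩ := Submodule.exists_le_ker_of_notMem hmem
    apply hφ
    let α : G.Edge → K := fun e => φ (Pi.single e 1)
    have hα : ∀ z, φ z = ∑ e, z e * α e := fun z => by
      conv_lhs => rw [LinearMap.pi_apply_eq_sum_univ φ z]
      refine Finset.sum_congr rfl fun e _ => ?_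
      rw [smul_eq_mul]
      congr 2
      ext e'
      simp [Pi.single_apply, eq_comm]
    let a : G.D → K := fun d => if G.IsInner d then
      (if d = G.rep (G.edge d) then α (G.edge d) else -α (G.edge d)) else 0
    have ha : ∀ d, a (G.opp d) = -a d := by
      intro d
      simp only [a, isInner_opp, G.edge_opp]
      rcases G.rep_edge d with h | h <;> rw [h]
      · rw [if_neg (G.opp_ne d), if_pos rfl]
        split_ifs <;> simp
      · rw [if_neg (G.opp_ne d).symm, if_pos rfl]
        split_ifs <;> simp
    have hrep : ∀ e, a (G.rep e) = if G.IsInner (G.rep e) then α e else 0 := by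
      intro e
      simp only [a, G.edge_rep, if_true]
    have hc : ∀ C : G.D → K, (∀ d, C (G.rot d) = C d) → ∑ d, C d * a d = 0 := by
      intro C hC
      have h : δ (Quot.lift C fun u v h => by rw [h, hC]) ∈ LinearMap.ker φ :=
        hle (LinearMap.mem_range_self _ _)
      rw [LinearMap.mem_ker, hα] at h
      rw [G.sum_eq_sum_edge, ← neg_eq_zero, ← h, ← Finset.sum_neg_distrib]
      refine Finset.sum_congr rfl fun e _ => ?_
      rw [ha, hrep, hδ]
      split_ifs <;> ring
    obtain ⟨x, hx0, hx⟩ := exists_interior_face_potential a ha hc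
      (fun d hd => if_neg hd)
    rw [hα, ← hf x hx0, G.sum_eq_sum_edge]
    refine Finset.sum_congr rfl fun e _ => ?_
    have h := hx (G.rep e)
    rw [hrep] at h
    rw [hω]
    by_cases hi : G.IsInner (G.rep e)
    · rw [if_pos hi] at h
      rw [h]
      ring
    · rw [h0 _ hi]
      ring

end Field

theorem exists_interior_face_potential_int (a : G.D → ℤ) (ha : ∀ d, a (G.opp d) = -a d)
    (hc : ∀ C : G.D → ℚ, (∀ d, C (G.rot d) = C d) → ∑ d, C d * a d = 0)
    (h0 : ∀ d, ¬ G.IsInner d → a d = 0) :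
    ∃ x : G.Face → ℤ, (∀ f, G.IsBoundaryFace f → x f = 0) ∧
      ∀ d, a d = x (G.leftFace d) - x (G.leftFace (G.opp d)) := by
  obtain ⟨x, hx0, hx⟩ := exists_interior_face_potential (fun d => (a d : ℚ))
    (fun d => by rw [ha, Int.cast_neg]) hc (fun d hd => by rw [h0 d hd, Int.cast_zero])
  have hint : ∀ f, ∃ z : ℤ, (z : ℚ) = x f := by
    refine forall_face (fun f hf => ⟨0, by rw [hx0 f hf, Int.cast_zero]⟩) ?_
    rintro d ⟨z, hz⟩
    exact ⟨z - a d, by rw [Int.cast_sub, hz, hx d]; ring⟩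
  choose z hz using hint
  refine ⟨z, fun f hf => ?_, fun d => ?_⟩
  · have := hz f
    rw [hx0 f hf] at this
    exact_mod_cast this
  · have := hx d
    rw [← hz, ← hz] at this
    exact_mod_cast this

end PlabicGraph

namespace PlabicGraph

variable {G : PlabicGraph}

lemma startsAt_rot (x : VertexColor) (d : G.D) : G.StartsAt x (G.rot d) ↔ G.StartsAt x d := by
  unfold StartsAt
  rcases h : G.org d with i | v
  · have h' : G.org (G.rot d) = Sum.inl ((finRotate G.N).symm i) := by
      have h1 := G.rot_bdry ((finRotate G.N).symm i)
      rw [Equiv.apply_symm_apply] at h1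
      rw [G.org_eq_inl_iff, (G.org_eq_inl_iff d i).1 h, h1]
    simp [h']
  · rw [G.org_rot d v h]

lemma startsAt_black_iff {d : G.D} (hd : G.IsInner d) :
    G.StartsAt .black d ↔ ¬ G.StartsAt .white d := by
  unfold StartsAt
  rcases h : G.org d with i | v
  · rw [(G.org_eq_inl_iff d i).1 h] at hd
    exact absurd hd (not_isInner_bdry i)
  · cases hv : G.color v <;> simp [hv]

open Classical in
/-- The indicator function of the half-edges at white vertices. -/
noncomputable def whiteInd (R : Type) [CommRing R] (d : G.D) : R :=
  if G.StartsAt .white d then 1 else 0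

lemma whiteInd_rot (R : Type) [CommRing R] (d : G.D) :
    whiteInd R (G.rot d) = whiteInd R d := by
  unfold whiteInd
  rw [startsAt_rot .white d]

lemma sum_faceStep_sub {R : Type} [CommRing R] (U : G.Face → R) (u : G.D → R) :
    ∑ d, U (G.leftFace d) * (u (G.faceStep d) - u d) = 0 := by
  simp_rw [mul_sub]
  rw [Finset.sum_sub_distrib, sub_eq_zero,
    ← Equiv.sum_comp (G.opp.trans G.rot) fun d => U (G.leftFace d) * u d]
  refine Finset.sum_congr rfl fun d _ => ?_
  change _ = U (G.leftFace (G.faceStep d)) * u (G.faceStep d)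
  rw [G.leftFace_faceStep]

open Classical in
lemma exchangeMatrix_apply (F F' : G.InteriorFace) :
    G.dualGraph.exchangeMatrix F F' = ∑ d : G.D,
      if G.leftFace d = F.1 ∧ G.leftFace (G.opp d) = F'.1 then
        whiteInd ℤ (G.opp d) - whiteInd ℤ d else 0 := by
  have harr : ∀ F F' : G.InteriorFace, (G.dualGraph.arr F F' : ℤ) = ∑ d : G.D,
      if G.StartsAt .white d ∧ G.StartsAt .black (G.opp d) ∧ G.leftFace (G.opp d) = F.1 ∧
        G.leftFace d = F'.1 then 1 else 0 := by
    intro F F'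
    rw [Finset.sum_boole, ← Fintype.card_subtype, ← Nat.card_eq_fintype_card]
    rfl
  unfold DiMultigraph.exchangeMatrix
  rw [harr, harr, ← Equiv.sum_comp G.opp, ← Finset.sum_sub_distrib]
  refine Finset.sum_congr rfl fun d _ => ?_
  rw [G.opp_opp]
  by_cases hd : G.leftFace d = F.1 ∧ G.leftFace (G.opp d) = F'.1
  · have hi : G.IsInner d := fun h => F.2 (hd.1 ▸ h.1)
    rw [if_pos hd, startsAt_black_iff hi, startsAt_black_iff (isInner_opp.2 hi)]
    unfold whiteInd
    by_cases h1 : G.StartsAt .white d <;> by_cases h2 : G.StartsAt .white (G.opp d) <;>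
      simp [h1, h2, hd.1, hd.2]
  · rw [if_neg hd, if_neg fun h => hd h.2.2, if_neg fun h => hd ⟨h.2.2.2, h.2.2.1⟩, sub_zero]

open Classical in
lemma exchangeMatrix_mulVec (X : G.Face → ℤ) (hX : ∀ f, G.IsBoundaryFace f → X f = 0)
    (F : G.InteriorFace) :
    G.dualGraph.exchangeMatrix.mulVec (fun F => X F.1) F = ∑ d : G.D,
      (if G.leftFace d = F.1 then 1 else 0) * ((whiteInd ℤ (G.opp d) - whiteInd ℤ d) *
        (X (G.leftFace d) + X (G.leftFace (G.opp d)))) := by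
  have h0 := sum_faceStep_sub (fun f => (if f = F.1 then 1 else 0) * X f) (whiteInd (G := G) ℤ)
  have h1 : G.dualGraph.exchangeMatrix.mulVec (fun F => X F.1) F = ∑ d : G.D,
      (if G.leftFace d = F.1 then 1 else 0) * ((whiteInd ℤ (G.opp d) - whiteInd ℤ d) *
        X (G.leftFace (G.opp d))) := by
    simp_rw [Matrix.mulVec, dotProduct, exchangeMatrix_apply, Finset.sum_mul]
    rw [Finset.sum_comm]
    refine Finset.sum_congr rfl fun d _ => ?_
    by_cases hd : G.leftFace d = F.1
    · by_cases hb : G.IsBoundaryFace (G.leftFace (G.opp d))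
      · rw [hX _ hb, mul_zero, mul_zero]
        refine Finset.sum_eq_zero fun F' _ => ?_
        have : G.leftFace (G.opp d) ≠ F'.1 := fun h => F'.2 (h ▸ hb)
        rw [if_neg fun h => this h.2, zero_mul]
      · rw [Finset.sum_eq_single ⟨_, hb⟩]
        · simp [hd]
        · intro F' _ hF'
          have : G.leftFace (G.opp d) ≠ F'.1 := fun h => hF' (Subtype.ext h.symm)
          rw [if_neg fun h => this h.2, zero_mul]
        · simp
    · simp [hd]
  rw [h1, ← add_zero (Finset.sum _ _)]
  refine (congrArg _ h0.symm).trans ?_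
  rw [← Finset.sum_add_distrib]
  refine Finset.sum_congr rfl fun d _ => ?_
  rw [DiskMap.faceStep, whiteInd_rot]
  ring

open Classical in
/-- The permutation of the half-edges which turns clockwise around the black vertices and
counterclockwise around the white ones. -/
noncomputable def turn (G : PlabicGraph) : Equiv.Perm G.D where
  toFun d := if G.StartsAt .white d then G.rot.symm d else G.rot d
  invFun d := if G.StartsAt .white d then G.rot d else G.rot.symm d
  left_inv d := by
    have h : G.StartsAt .white (G.rot.symm d) ↔ G.StartsAt .white d := by
      rw [← startsAt_rot, Equiv.apply_symm_apply]
    by_cases hd : G.StartsAt .white d <;> simp [hd, h, startsAt_rot]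
  right_inv d := by
    have h : G.StartsAt .white (G.rot.symm d) ↔ G.StartsAt .white d := by
      rw [← startsAt_rot, Equiv.apply_symm_apply]
    by_cases hd : G.StartsAt .white d <;> simp [hd, h, startsAt_rot]

lemma turn_of_white {d : G.D} (hd : G.StartsAt .white d) : G.turn d = G.rot.symm d := if_pos hd

lemma turn_of_not_white {d : G.D} (hd : ¬ G.StartsAt .white d) : G.turn d = G.rot d := if_neg hd

lemma rotInvariant_symm {α : Type*} {C : G.D → α} (hC : ∀ d, C (G.rot d) = C d) (d : G.D) :
    C (G.rot.symm d) = C d := by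
  rw [← hC, Equiv.apply_symm_apply]

lemma rotInvariant_turn {α : Type*} {C : G.D → α} (hC : ∀ d, C (G.rot d) = C d) (d : G.D) :
    C (G.turn d) = C d := by
  by_cases hd : G.StartsAt .white d
  · rw [turn_of_white hd, rotInvariant_symm hC]
  · rw [turn_of_not_white hd, hC]

lemma leftFace_opp_rot_symm (d : G.D) :
    G.leftFace (G.opp (G.rot.symm d)) = G.leftFace d := by
  rw [← G.leftFace_rot, Equiv.apply_symm_apply]

section ZigZag

variable {R : Type} [CommRing R]

/-- `h` is a function on the zigzag paths (turning back at the edges between boundary faces) such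
that the corresponding combination of zigzag paths is the boundary of `X`. -/
structure IsZigZagPotential (X : G.Face → R) (h : G.D → R) : Prop where
  opp : ∀ d, G.IsInner d → h d - h (G.opp d) = X (G.leftFace d) - X (G.leftFace (G.opp d))
  turn : ∀ d, h d - h (G.turn d) = X (G.leftFace d) - X (G.leftFace (G.opp d))

open Classical in
lemma isZigZagPotential_of_vertex_potential (X : G.Face → R) (C : G.D → R)
    (hC : ∀ d, C (G.rot d) = C d)
    (h : ∀ d, G.IsInner d → (whiteInd R (G.opp d) - whiteInd R d) *
      (X (G.leftFace d) + X (G.leftFace (G.opp d))) = C (G.opp d) - C d) :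
    IsZigZagPotential X fun d =>
      (if G.StartsAt .white d then -X (G.leftFace (G.opp d)) else X (G.leftFace d)) + C d where
  opp d hd := by
    have h := h d hd
    unfold whiteInd at h
    rw [G.opp_opp]
    split_ifs at h ⊢ <;> linear_combination h
  turn d := by
    rw [rotInvariant_turn hC]
    have hw := rotInvariant_turn (C := fun d => G.StartsAt .white d)
      (fun d => propext (startsAt_rot _ _)) d
    simp only [hw]
    by_cases hd : G.StartsAt .white d
    · rw [if_pos hd, if_pos hd, turn_of_white hd, leftFace_opp_rot_symm]
      ring
    · rw [if_neg hd, if_neg hd, turn_of_not_white hd, G.leftFace_rot]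
      ring

open Classical in
lemma IsZigZagPotential.exists_vertex_potential {X : G.Face → R} {h : G.D → R}
    (H : IsZigZagPotential X h) :
    ∃ C : G.D → R, (∀ d, C (G.rot d) = C d) ∧
      ∀ d, G.IsInner d → (whiteInd R (G.opp d) - whiteInd R d) *
        (X (G.leftFace d) + X (G.leftFace (G.opp d))) = C (G.opp d) - C d := by
  refine ⟨fun d =>
    h d - if G.StartsAt .white d then -X (G.leftFace (G.opp d)) else X (G.leftFace d), ?_, ?_⟩
  · intro d
    simp only [startsAt_rot]
    by_cases hd : G.StartsAt .white d
    · have h1 := H.turn (G.rot d)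
      rw [turn_of_white ((startsAt_rot _ _).2 hd), Equiv.symm_apply_apply] at h1
      rw [if_pos hd, if_pos hd, ← G.leftFace_rot d]
      linear_combination h1
    · have h1 := H.turn d
      rw [turn_of_not_white hd] at h1
      rw [if_neg hd, if_neg hd, G.leftFace_rot]
      linear_combination -h1
  · intro d hd
    have h1 := H.opp d hd
    unfold whiteInd
    simp only [G.opp_opp]
    split_ifs <;> linear_combination h1

end ZigZag

/-- Zigzag combinations lie in the kernel of the exchange matrix. -/
lemma IsZigZagPotential.mulVec_eq_zero {X : G.Face → ℤ} {h : G.D → ℤ}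
    (H : IsZigZagPotential X h) (hX : ∀ f, G.IsBoundaryFace f → X f = 0) :
    G.dualGraph.exchangeMatrix.mulVec (fun F => X F.1) = 0 := by
  classical
  obtain ⟨C, hC, hCX⟩ := H.exists_vertex_potential
  ext F
  rw [exchangeMatrix_mulVec X hX]
  refine Eq.trans ?_ (sum_faceStep_sub (fun f => if f = F.1 then 1 else 0) C)
  refine Finset.sum_congr rfl fun d _ => ?_
  by_cases hd : G.leftFace d = F.1
  · rw [hCX d fun h => F.2 (hd ▸ h.1), DiskMap.faceStep, hC]
  · rw [if_neg hd, zero_mul, zero_mul]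

/-- A vector in the kernel of the exchange matrix modulo `p` is a zigzag combination. -/
lemma exists_isZigZagPotential_zmod (p : ℕ) [Fact p.Prime] (X : G.Face → ℤ)
    (hX : ∀ f, G.IsBoundaryFace f → X f = 0)
    (hB : ∀ F, (p : ℤ) ∣ G.dualGraph.exchangeMatrix.mulVec (fun F => X F.1) F) :
    ∃ h : G.D → ZMod p, IsZigZagPotential (fun f => (X f : ZMod p)) h := by
  classical
  obtain ⟨C, hC, hCX⟩ := exists_vertex_potential (K := ZMod p)
    (fun d : G.D => (whiteInd (ZMod p) (G.opp d) - whiteInd (ZMod p) d) *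
      ((X (G.leftFace d) : ZMod p) + (X (G.leftFace (G.opp d)) : ZMod p)))
    (fun d => by rw [G.opp_opp]; ring)
    (fun d hd => by
      have hd := not_not.1 hd
      rw [hX _ hd.1, hX _ hd.2]
      simp)
    (fun Y hY => by
      have hfib : ∀ F : G.Face, Y F * ∑ d : G.D, (if G.leftFace d = F then 1 else 0) *
          ((whiteInd (ZMod p) (G.opp d) - whiteInd (ZMod p) d) *
          ((X (G.leftFace d) : ZMod p) + (X (G.leftFace (G.opp d)) : ZMod p))) = 0 := by
        intro F
        by_cases hF : G.IsBoundaryFace F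
        · rw [hY F hF, zero_mul]
        · have h := (ZMod.intCast_zmod_eq_zero_iff_dvd _ p).2 (hB ⟨F, hF⟩)
          rw [exchangeMatrix_mulVec X hX, Int.cast_sum] at h
          refine (congrArg (Y F * ·) (Eq.trans ?_ h)).trans (mul_zero _)
          refine Finset.sum_congr rfl fun d _ => ?_
          unfold whiteInd
          push_cast
          rfl
      have : Fintype G.Face := Fintype.ofFinite _
      refine Eq.trans ?_ (Finset.sum_eq_zero (s := Finset.univ) fun F _ => hfib F)
      simp_rw [Finset.mul_sum]
      rw [Finset.sum_comm]
      refine Finset.sum_congr rfl fun d _ => ?_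
      rw [Finset.sum_eq_single (G.leftFace d)]
      · rw [if_pos rfl, one_mul]
      · intro F _ hF
        rw [if_neg hF.symm, zero_mul, mul_zero]
      · simp)
  exact ⟨_, isZigZagPotential_of_vertex_potential _ C hC hCX⟩

/-- The kernel of the exchange matrix modulo `p` is the reduction of the integral kernel. -/
theorem exists_mem_ker_congr (p : ℕ) [Fact p.Prime] (x : G.InteriorFace → ℤ)
    (hB : ∀ F, (p : ℤ) ∣ G.dualGraph.exchangeMatrix.mulVec x F) :
    ∃ x', G.dualGraph.exchangeMatrix.mulVec x' = 0 ∧ ∀ F, (p : ℤ) ∣ x F - x' F := by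
  classical
  let X : G.Face → ℤ := fun f => if hf : G.IsBoundaryFace f then 0 else x ⟨f, hf⟩
  have hX : ∀ f, G.IsBoundaryFace f → X f = 0 := fun f hf => dif_pos hf
  have hXx : (fun F : G.InteriorFace => X F.1) = x := by
    ext F
    exact dif_neg F.2
  obtain ⟨h, H⟩ := exists_isZigZagPotential_zmod p X hX (by rwa [hXx])
  have hlift := Function.surjInv_eq (ZMod.intCast_surjective (n := p))
  set lift := Function.surjInv (ZMod.intCast_surjective (n := p))
  let g : G.D → ℤ := fun d => if G.IsInner d then lift (h d) - lift (h (G.opp d)) else 0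
  have hg : ∀ d, g d = lift (h d) - lift (h (G.turn d)) := by
    intro d
    have h2 := H.turn d
    by_cases hd : G.IsInner d
    · have h1 := H.opp d hd
      rw [← h2, sub_right_inj] at h1
      simp only [g, if_pos hd, h1]
    · have hd' := not_not.1 hd
      simp only [hX _ hd'.1, hX _ hd'.2, sub_self, sub_eq_zero] at h2
      simp only [g, if_neg hd, ← h2, sub_self]
  obtain ⟨X', hX'0, hX'⟩ := exists_interior_face_potential_int g
    (fun d => by
      simp only [g, isInner_opp, G.opp_opp]
      split_ifs <;> ring)
    (fun C hC => by
      simp_rw [hg, Int.cast_sub, mul_sub]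
      rw [Finset.sum_sub_distrib, sub_eq_zero,
        ← Equiv.sum_comp G.turn fun d => C d * (lift (h d) : ℚ)]
      refine Finset.sum_congr rfl fun d _ => ?_
      rw [rotInvariant_turn hC])
    (fun d hd => if_neg hd)
  have H' : IsZigZagPotential X' (fun d => lift (h d)) :=
    ⟨fun d hd => by rw [← hX']; simp only [g, if_pos hd], fun d => by rw [← hX', hg]⟩
  refine ⟨_, H'.mulVec_eq_zero hX'0, fun F => ?_⟩
  rw [← hXx]
  revert F
  suffices ∀ f, (p : ℤ) ∣ X f - X' f from fun F => this F.1
  refine forall_face (fun f hf => by rw [hX f hf, hX'0 f hf, sub_zero]; exact dvd_zero _) ?_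
  intro d hd
  rw [← ZMod.intCast_zmod_eq_zero_iff_dvd] at hd ⊢
  push_cast at hd ⊢
  have h1 := congrArg (Int.cast : ℤ → ZMod p) (hX' d)
  rw [hg] at h1
  push_cast at h1
  rw [hlift, hlift, H.turn] at h1
  linear_combination hd - h1

end PlabicGraph

namespace DiMultigraph

variable {V : Type}

lemma exchangeMatrix_transpose (Q : DiMultigraph V) :
    Q.exchangeMatrix.transpose = -Q.exchangeMatrix := by
  ext i j
  simp [exchangeMatrix]

lemma exchangeMatrix_red (Q : DiMultigraph V) : Q.red.exchangeMatrix = Q.exchangeMatrix := by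
  ext i j
  simp only [exchangeMatrix, red]
  omega

variable [Fintype V]

lemma torsionFree_of_prime (Q : DiMultigraph V)
    (h : ∀ (p : ℕ) [Fact p.Prime] (x : V → ℤ), (∀ i, (p : ℤ) ∣ Q.exchangeMatrix.mulVec x i) →
      ∃ x', Q.exchangeMatrix.mulVec x' = 0 ∧ ∀ i, (p : ℤ) ∣ x i - x' i) :
    Q.TorsionFree := by
  set N := LinearMap.range Q.exchangeMatrix.transpose.mulVecLin with hN
  have mem : ∀ y, y ∈ N ↔ ∃ x, Q.exchangeMatrix.mulVec x = y := by
    intro y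
    rw [hN, LinearMap.mem_range]
    simp only [exchangeMatrix_transpose, Matrix.mulVecLin_apply]
    constructor
    · rintro ⟨x, hx⟩
      exact ⟨-x, by rw [Matrix.mulVec_neg, ← Matrix.neg_mulVec, hx]⟩
    · rintro ⟨x, hx⟩
      exact ⟨-x, by rw [Matrix.mulVec_neg, Matrix.neg_mulVec, neg_neg, hx]⟩
  have prime : ∀ (p : ℕ), p.Prime → ∀ y, p • y ∈ N → y ∈ N := by
    intro p hp y hy
    have : Fact p.Prime := ⟨hp⟩
    obtain ⟨x, hx⟩ := (mem _).1 hy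
    obtain ⟨x', hx', hd⟩ := h p x fun i => ⟨y i, by rw [hx]; simp⟩
    choose z hz using hd
    refine (mem _).2 ⟨z, ?_⟩
    have hxz : x = x' + p • z := by
      ext i
      have := hz i
      simp only [Pi.add_apply, Pi.smul_apply, Int.nsmul_eq_mul] at this ⊢
      linarith
    rw [hxz, Matrix.mulVec_add, hx', zero_add, Matrix.mulVec_smul] at hx
    exact smul_right_injective _ hp.ne_zero hx
  have all : ∀ n : ℕ, n ≠ 0 → ∀ y, n • y ∈ N → y ∈ N := by
    intro n
    induction n using Nat.recOnMul with
    | zero => exact fun h => absurd rfl h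
    | one => exact fun _ y hy => by rwa [one_smul] at hy
    | prime p hp => exact fun _ => prime p hp
    | mul a b iha ihb =>
      intro hn y hy
      rw [mul_smul] at hy
      exact ihb (right_ne_zero_of_mul hn) _ (iha (left_ne_zero_of_mul hn) _ hy)
  refine ⟨fun n hn a b hab => ?_⟩
  induction a using Submodule.Quotient.induction_on with
  | H a =>
  induction b using Submodule.Quotient.induction_on with
  | H b =>
  rw [Submodule.Quotient.eq]
  apply all n hn
  rw [smul_sub, ← Submodule.Quotient.eq]
  exact hab

/-- The rank over `ℚ` of an integer matrix is the rank over `ℤ`. -/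
lemma _root_.Matrix.rank_map_intCast {m n : Type} [Fintype m] [Fintype n] (A : Matrix m n ℤ) :
    (A.map (Int.cast : ℤ → ℚ)).rank = finrank ℤ (LinearMap.range A.mulVecLin) := by
  set N := LinearMap.range A.mulVecLin with hN
  let b := Module.finBasis ℤ N
  let c : (m → ℤ) →ₗ[ℤ] (m → ℚ) := (Algebra.linearMap ℤ ℚ).compLeft m
  have hc : Function.Injective c := fun x y hxy => by
    ext i
    exact Int.cast_injective (congrFun hxy i)
  have hli : LinearIndependent ℤ fun i => c (b i) :=
    (b.linearIndependent.map' N.subtype (Submodule.ker_subtype N)).map' c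
      (LinearMap.ker_eq_bot.2 hc)
  have hliQ : LinearIndependent ℚ fun i => c (b i) :=
    (LinearIndependent.iff_fractionRing ℤ ℚ).1 hli
  have hspan : Submodule.span ℚ (Set.range (A.map (Int.cast : ℤ → ℚ)).col) =
      Submodule.span ℚ (Set.range fun i => c (b i)) := by
    have hcol : ∀ j, (A.map (Int.cast : ℤ → ℚ)).col j = c (A.col j) := fun j => rfl
    apply le_antisymm <;> rw [Submodule.span_le]
    · rintro _ ⟨j, rfl⟩
      have hj : A.col j ∈ N := by
        rw [hN, Matrix.range_mulVecLin]
        exact Submodule.subset_span ⟨j, rfl⟩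
      have := b.sum_repr ⟨_, hj⟩
      have := congrArg (fun z : N => c z) this
      simp only [Submodule.coe_sum, map_sum, Submodule.coe_smul, map_smul] at this
      rw [hcol, SetLike.mem_coe, ← this]
      refine Submodule.sum_mem _ fun i _ => ?_
      rw [← Int.cast_smul_eq_zsmul ℚ]
      exact Submodule.smul_mem _ _ (Submodule.subset_span ⟨i, rfl⟩)
    · rintro _ ⟨i, rfl⟩
      obtain ⟨x, hx⟩ := (b i).2
      have : c (b i) = ∑ j, (x j : ℚ) • (A.map (Int.cast : ℤ → ℚ)).col j := by
        rw [← hx]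
        ext k
        simp [c, Matrix.mulVec, dotProduct, mul_comm]
      rw [SetLike.mem_coe]
      simp only [this]
      exact Submodule.sum_mem _ fun j _ =>
        Submodule.smul_mem _ _ (Submodule.subset_span ⟨j, rfl⟩)
  rw [Matrix.rank_eq_finrank_span_cols, hspan, finrank_span_eq_card hliQ, Fintype.card_fin]

/-- The ice quiver obtained by adding frozen vertices with prescribed rows of the extended
exchange matrix. -/
def frozenExtension {M : Type} (Q : DiMultigraph V) (hQ : Q.IsQuiver) (c : M → V → ℤ) :
    IceQuiver V M where
  arr
    | .inl u, .inl v => Q.arr u v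
    | .inl u, .inr k => (c k u)⁻.toNat
    | .inr k, .inl u => (c k u)⁺.toNat
    | .inr _, .inr _ => 0
  isQuiver := by
    refine ⟨?_, ?_⟩
    · rintro (u | k)
      · exact hQ.1 u
      · rfl
    · have h : ∀ z : ℤ, z⁺.toNat = 0 ∨ z⁻.toNat = 0 := fun z => by
        rw [posPart_def, negPart_def]
        omega
      rintro (u | k) (v | l)
      · exact hQ.2 u v
      · exact (h _).symm
      · exact h _
      · exact Or.inl rfl
  frozen_arr _ _ := rfl

theorem exists_isMinimalExtension (Q : DiMultigraph V) (hQ : Q.IsQuiver) (hT : Q.TorsionFree) :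
    ∃ (m : ℕ) (Qt : IceQuiver V (Fin m)), IsMinimalExtension Q Qt := by
  set N := LinearMap.range Q.exchangeMatrix.transpose.mulVecLin with hN
  have : IsAddTorsionFree ((V → ℤ) ⧸ N) := hT
  have : IsTorsionFree ℤ ((V → ℤ) ⧸ N) := isTorsionFree_int_iff_isAddTorsionFree.2 this
  let b := Module.finBasis ℤ ((V → ℤ) ⧸ N)
  have hrank : finrank ℤ ((V → ℤ) ⧸ N) = Q.cork := by
    have h := Submodule.finrank_quotient_add_finrank N
    rw [finrank_fintype_fun_eq_card, hN, ← Matrix.rank_map_intCast, Matrix.transpose_map,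
      Matrix.rank_transpose, ← hN] at h
    unfold cork
    omega
  choose c hc using fun k => N.mkQ_surjective (b k)
  refine ⟨_, Q.frozenExtension hQ c, rfl, hrank, ?_⟩
  set S := Submodule.span ℤ (Set.range fun i => (Q.frozenExtension hQ c).extExchangeMatrix i)
    with hS
  change S = ⊤
  have hNS : N ≤ S := by
    rw [hN, Matrix.range_mulVecLin, Submodule.span_le]
    rintro _ ⟨i, rfl⟩
    exact Submodule.subset_span ⟨Sum.inl i, rfl⟩
  have hcS : ∀ k, c k ∈ S := by
    intro k
    refine Submodule.subset_span ⟨Sum.inr k, ?_⟩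
    ext j
    change (((c k j)⁺.toNat : ℕ) : ℤ) - (((c k j)⁻.toNat : ℕ) : ℤ) = c k j
    rw [Int.toNat_of_nonneg (posPart_nonneg _), Int.toNat_of_nonneg (negPart_nonneg _),
      posPart_sub_negPart]
  have hmap : Submodule.map N.mkQ S = ⊤ := by
    rw [eq_top_iff, ← b.span_eq, Submodule.span_le]
    rintro _ ⟨k, rfl⟩
    exact ⟨c k, hcS k, hc k⟩
  rw [← sup_eq_right.2 hNS, ← Submodule.comap_map_mkQ, hmap, Submodule.comap_top]

end DiMultigraph

lemma PlabicGraph.dualGraph_torsionFree (G : PlabicGraph) : G.dualGraph.TorsionFree :=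
  G.dualGraph.torsionFree_of_prime fun p _ x hx => exists_mem_ker_congr p x hx

theorem mainTheorem6 :
    (∀ G : PlabicGraph, G.reducedDualQuiver.TorsionFree) ∧
    (∀ G : PlabicGraph, G.IsSimple →
      ∃ (m : ℕ) (Qt : IceQuiver G.InteriorFace (Fin m)), IsMinimalExtension G.dualGraph Qt) := by
  refine ⟨fun G => ?_, fun G hG =>
    G.dualGraph.exists_isMinimalExtension hG G.dualGraph_torsionFree⟩
  have h := G.dualGraph_torsionFree
  unfold DiMultigraph.TorsionFree at h ⊢
  rwa [PlabicGraph.reducedDualQuiver, DiMultigraph.exchangeMatrix_red]
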